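/- Let $n\in\mathbb{N}$ and let $M\subset\mathbb{R}^n$ be a compact connected (non-empty) hypersurface, i.e. a smooth embedded submanifold of codimension one without boundary. For $x\in M$ regard the tangent space $T_xM$ as a linear subspace of $\mathbb{R}^n$, and put $$\alpha(M):=\#\bigl\{\{x,y\}\subset M \;\big|\; x\neq y,\ T_xM=T_yM=(x-y)^\perp\bigr\}\in\mathbb{N}_0\cup\{\infty\},$$ the number of such unordered pairs, where $\perp$ is taken with respect to the Euclidean inner product. Let $\mathrm{TC}(M)\in\mathbb{N}\cup\{\infty\}$ denote the (non-reduced) topological complexity of $M$: the least $k$ for which there are open sets $U_1,\dots,U_k$ covering $M\times M$ such that, for each $i$, there is a continuous map $s_i\colon U_i\to C([0,1],M)$ (compact-open topology) with $s_i(x,y)(0)=x$ and $s_i(x,y)(1)=y$ for all $(x,y)\in U_i$ (and $\infty$ if no such $k$ exists). Then $$\alpha(M)\ \geq\ \mathrm{TC}(M)-1 .$$ In particular, there are at least $\mathrm{TC}(M)-1$ distinct unordered pairs $\{x,y\}\subset M$ with $x\neq y$ and $T_xM=T_yM$. -/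

import Mathlib

open scoped ContDiff unitInterval

noncomputable section

/-- `U` admits a continuous motion planner, that is, a continuous local section over `U` of the path
fibration `PX → X × X`, `γ ↦ (γ 0, γ 1)`. The space `PX = C(I, X)` of all continuous paths in `X`
carries the compact-open topology. -/
def HasMotionPlanner {X : Type*} [TopologicalSpace X] (U : Set (X × X)) : Prop :=
  ∃ s : U → C(I, X), Continuous s ∧ ∀ p : U, s p 0 = (p : X × X).1 ∧ s p 1 = (p : X × X).2

/-- The (non-reduced) topological complexity `TC(X)`: the least `m` such that `X × X` is covered by
`m` open subsets each of which admits a continuous motion planner, and `⊤` if there is no such `m`.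
Thus a one-point space has topological complexity `1`. -/
def topologicalComplexity (X : Type*) [TopologicalSpace X] : ℕ∞ :=
  sInf {k : ℕ∞ | ∃ m : ℕ, k = m ∧ ∃ U : Fin m → Set (X × X),
    (∀ i, IsOpen (U i) ∧ HasMotionPlanner (U i)) ∧ ⋃ i, U i = Set.univ}

/-- `M` is a smooth embedded hypersurface of `ℝⁿ` (without boundary): around each of its points there
is a smooth local diffeomorphism `Φ` of `ℝⁿ` which flattens `M` to a coordinate hyperplane. -/
def IsSmoothHypersurface {n : ℕ} (M : Set (EuclideanSpace ℝ (Fin n))) : Prop :=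
  ∀ x ∈ M, ∃ Φ : OpenPartialHomeomorph (EuclideanSpace ℝ (Fin n)) (EuclideanSpace ℝ (Fin n)),
    x ∈ Φ.source ∧ ContDiffOn ℝ ∞ Φ Φ.source ∧ ContDiffOn ℝ ∞ Φ.symm Φ.target ∧
      ∃ i : Fin n, ∀ p ∈ Φ.source, p ∈ M ↔ Φ p i = 0

/-- The tangent space `T_xM ⊆ ℝⁿ`, as the set of velocities at `x` of smooth curves in `M`. -/
def tangentSpaceAt {n : ℕ} (M : Set (EuclideanSpace ℝ (Fin n))) (x : EuclideanSpace ℝ (Fin n)) :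
    Set (EuclideanSpace ℝ (Fin n)) :=
  {v | ∃ ε > (0 : ℝ), ∃ γ : ℝ → EuclideanSpace ℝ (Fin n),
    ContDiffOn ℝ ∞ γ (Set.Ioo (-ε) ε) ∧ (∀ t ∈ Set.Ioo (-ε) ε, γ t ∈ M) ∧
      γ 0 = x ∧ HasDerivAt γ v 0}

/-- The unordered pairs `{x, y}` of distinct points of `M` with `T_xM = T_yM = (x - y)^⊥`. -/
def doubleNormalPairs {n : ℕ} (M : Set (EuclideanSpace ℝ (Fin n))) :
    Set (Sym2 (EuclideanSpace ℝ (Fin n))) :=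
  {p | ∃ x ∈ M, ∃ y ∈ M, p = s(x, y) ∧ x ≠ y ∧ tangentSpaceAt M x = tangentSpaceAt M y ∧
    tangentSpaceAt M y = {v | inner ℝ (x - y) v = 0}}

/-- The unordered pairs `{x, y}` of distinct points of `M` with `T_xM = T_yM`. -/
def parallelPairs {n : ℕ} (M : Set (EuclideanSpace ℝ (Fin n))) :
    Set (Sym2 (EuclideanSpace ℝ (Fin n))) :=
  {p | ∃ x ∈ M, ∃ y ∈ M, p = s(x, y) ∧ x ≠ y ∧ tangentSpaceAt M x = tangentSpaceAt M y}

/-- The number `α(M)` of unordered pairs `{x, y}` of distinct points of `M` with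
`T_xM = T_yM = (x - y)^⊥`, which is `⊤` if there are infinitely many. -/
def alphaCount {n : ℕ} (M : Set (EuclideanSpace ℝ (Fin n))) : ℕ∞ :=
  (doubleNormalPairs M).encard

end

/-!
The proof is Lusternik–Schnirelmann theory for the squared distance `f (x, y) = ‖x - y‖ ^ 2` on
`M × M`. Its zero set is the diagonal. If `(x, y)` with `x ≠ y` is such that `x - y` is orthogonal to
both tangent spaces, then `{x, y}` is a double normal pair, because a hyperplane contained in
`(x - y)^⊥` equals it. At any other off-diagonal point one of the two coordinates can be pushed
along `M`, in a flattening chart, so that `f` decreases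
(`isRegularPoint_of_notMem_doubleNormalPairs`).

Instead of a gradient flow only such pushes, cut off to be globally defined, and their finite
composites are used: by compactness, a composite takes sublevel sets just above a level `c` to just
below `c`, apart from a neighbourhood of the critical points at that level
(`exists_deformation_across_level`). Motion planners pull back along self-maps of `M × M` homotopic
to the identity (`HasMotionPlanner.preimage`), and finitely many critical points have a common
neighbourhood with a motion planner. So passing a positive critical level costs one further open set,
and passing any other level costs none. The count starts with one neighbourhood of the diagonal,
which pushes of the first coordinate onto the second in charts sweep into the diagonal
(`exists_isOpen_diagonal_hasMotionPlanner`).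

Hence `TC(M) - 1` is at most the number of positive critical values
(`topologicalComplexity_le_encard_add_one`), which is at most the number of double normal pairs, as
`f` is symmetric.
-/

/-! ### Motion planners -/

section MotionPlanner

open ContinuousMap Topology

variable {X : Type*} [TopologicalSpace X]

/-- By currying, a motion planner over `U` is a homotopy between the two projections `U → X`. -/
lemma hasMotionPlanner_iff_homotopic {U : Set (X × X)} :
    HasMotionPlanner U ↔
      ((fst : C(X × X, X)).restrict U).Homotopic ((snd : C(X × X, X)).restrict U) := by
  constructor
  · rintro ⟨s, hs, h⟩
    exact ⟨⟨⟨fun q => s q.2 q.1, by fun_prop⟩, fun p => (h p).1, fun p => (h p).2⟩⟩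
  · rintro ⟨F⟩
    refine ⟨fun p => (F.toContinuousMap.comp ⟨Prod.swap, continuous_swap⟩).curry p,
      ContinuousMap.continuous _, fun p => ⟨F.apply_zero p, F.apply_one p⟩⟩

lemma HasMotionPlanner.mono {U V : Set (X × X)} (hV : HasMotionPlanner V) (h : U ⊆ V) :
    HasMotionPlanner U := by
  obtain ⟨s, hs, hp⟩ := hV
  exact ⟨fun p => s ⟨p, h p.2⟩, by fun_prop, fun p => hp ⟨p, h p.2⟩⟩

lemma hasMotionPlanner_empty : HasMotionPlanner (∅ : Set (X × X)) :=
  ⟨fun p => p.2.elim, continuous_of_const fun p => p.2.elim, fun p => p.2.elim⟩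

lemma hasMotionPlanner_diagonal : HasMotionPlanner (Set.diagonal X) :=
  ⟨fun p => .const _ p.1.1, continuous_const'.comp (by fun_prop), fun p => ⟨rfl, p.2⟩⟩

/-- Motion planners pull back along self-maps of `X × X` homotopic to the identity: follow the first
coordinate of the homotopy, then the planner, then the second coordinate backwards. -/
lemma HasMotionPlanner.preimage {V : Set (X × X)} (hV : HasMotionPlanner V)
    {g : C(X × X, X × X)} (hg : g.Homotopic (.id _)) : HasMotionPlanner (g ⁻¹' V) := by
  rw [hasMotionPlanner_iff_homotopic] at hV ⊢
  let j : C(g ⁻¹' V, V) := ⟨fun p => ⟨g p, p.2⟩, by fun_prop⟩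
  let i : C(g ⁻¹' V, X × X) := (ContinuousMap.id _).restrict _
  have h1 := ((Homotopic.refl (fst : C(X × X, X))).comp hg).comp (.refl i)
  have h2 := ((Homotopic.refl (snd : C(X × X, X))).comp hg).comp (.refl i)
  exact h1.symm.trans ((hV.comp (.refl j)).trans h2)

lemma HasMotionPlanner.union {U V : Set (X × X)} (hU : HasMotionPlanner U)
    (hV : HasMotionPlanner V) (hUo : IsOpen U) (hVo : IsOpen V) (hd : Disjoint U V) :
    HasMotionPlanner (U ∪ V) := by
  classical
  obtain ⟨s, hs, hsp⟩ := hU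
  obtain ⟨t, ht, htp⟩ := hV
  have hnot : ∀ p ∈ V, p ∉ U := fun p hp h => Set.disjoint_left.1 hd h hp
  let r : (U ∪ V : Set (X × X)) → C(I, X) := fun p =>
    if h : (p : X × X) ∈ U then s ⟨p, h⟩ else t ⟨p, p.2.resolve_left h⟩
  refine ⟨r, continuous_iff_continuousAt.2 ?_, ?_⟩
  · rintro ⟨p, hp | hp⟩
    · have : IsOpen {q : (U ∪ V : Set (X × X)) | (q : X × X) ∈ U} :=
        hUo.preimage continuous_subtype_val
      refine ContinuousOn.continuousAt ?_ (this.mem_nhds hp)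
      rw [continuousOn_iff_continuous_domRestrict]
      have : Set.domRestrict {q : (U ∪ V : Set (X × X)) | (q : X × X) ∈ U} r =
          fun q => s ⟨q.1.1, q.2⟩ := by
        ext1 q
        exact dif_pos q.2
      rw [this]
      fun_prop
    · have : IsOpen {q : (U ∪ V : Set (X × X)) | (q : X × X) ∈ V} :=
        hVo.preimage continuous_subtype_val
      refine ContinuousOn.continuousAt ?_ (this.mem_nhds hp)
      rw [continuousOn_iff_continuous_domRestrict]
      have : Set.domRestrict {q : (U ∪ V : Set (X × X)) | (q : X × X) ∈ V} r =
          fun q => t ⟨q.1.1, q.2⟩ := by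
        ext1 q
        exact dif_neg (hnot _ q.2)
      rw [this]
      fun_prop
  · rintro ⟨p, hp⟩
    by_cases h : p ∈ U
    · simpa [r, h] using hsp ⟨p, h⟩
    · simpa [r, h] using htp ⟨p, hp.resolve_left h⟩

/-- A planner near the diagonal connects nearby points, so a connected `X` is path connected. -/
lemma joined_of_hasMotionPlanner [ConnectedSpace X] {D : Set (X × X)} (hDo : IsOpen D)
    (hD : HasMotionPlanner D) (hdiag : ∀ x : X, (x, x) ∈ D) (x y : X) : Joined x y := by
  obtain ⟨s, hs, hsp⟩ := hD
  have key : ∀ p ∈ D, Joined p.1 p.2 := fun p hp =>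
    ⟨⟨s ⟨p, hp⟩, (hsp ⟨p, hp⟩).1, (hsp ⟨p, hp⟩).2⟩⟩
  refine PreconnectedSpace.induction₂' Joined (fun x => ?_) ⟨fun _ _ _ => Joined.trans⟩ x y
  have : ∀ᶠ y in 𝓝 x, (x, y) ∈ D :=
    (Continuous.prodMk_right x).continuousAt.eventually_mem (hDo.mem_nhds (hdiag x))
  filter_upwards [this] with y hy using ⟨key _ hy, (key _ hy).symm⟩

/-- Near `(x₀, y₀)`: contract to `x₀`, follow a fixed path to `y₀`, and undo the contraction. -/
lemma exists_isOpen_hasMotionPlanner_of_mem [ConnectedSpace X] {D : Set (X × X)} (hDo : IsOpen D)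
    (hD : HasMotionPlanner D) (hdiag : ∀ x : X, (x, x) ∈ D) (p : X × X) :
    ∃ U, IsOpen U ∧ p ∈ U ∧ HasMotionPlanner U := by
  obtain ⟨γ⟩ := joined_of_hasMotionPlanner hDo hD hdiag p.1 p.2
  rw [hasMotionPlanner_iff_homotopic] at hD
  let U : Set (X × X) := {q | (q.1, p.1) ∈ D ∧ (q.2, p.2) ∈ D}
  have hU : IsOpen U :=
    (hDo.preimage (by fun_prop : Continuous fun q : X × X => (q.1, p.1))).inter
      (hDo.preimage (by fun_prop : Continuous fun q : X × X => (q.2, p.2)))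
  refine ⟨U, hU, ⟨hdiag _, hdiag _⟩, hasMotionPlanner_iff_homotopic.2 ?_⟩
  let j₁ : C(U, D) := ⟨fun q => ⟨(q.1.1, p.1), q.2.1⟩, by fun_prop⟩
  let j₂ : C(U, D) := ⟨fun q => ⟨(q.1.2, p.2), q.2.2⟩, by fun_prop⟩
  have h : (ContinuousMap.const U p.1).Homotopic (ContinuousMap.const U p.2) :=
    ⟨⟨⟨fun q => γ q.1, by fun_prop⟩, fun _ => γ.source, fun _ => γ.target⟩⟩
  exact (hD.comp (.refl j₁)).trans (h.trans (hD.comp (.refl j₂)).symm)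

/-- Finitely many points have disjoint neighbourhoods, on each of which there is a planner. -/
lemma exists_isOpen_hasMotionPlanner_of_finite [ConnectedSpace X] [T2Space X] {D : Set (X × X)}
    (hDo : IsOpen D) (hD : HasMotionPlanner D) (hdiag : ∀ x : X, (x, x) ∈ D) {K : Set (X × X)}
    (hK : K.Finite) : ∃ U, IsOpen U ∧ K ⊆ U ∧ HasMotionPlanner U := by
  induction K, hK using Set.Finite.induction_on with
  | empty => exact ⟨∅, isOpen_empty, subset_rfl, hasMotionPlanner_empty⟩
  | @insert p K hp hK ih =>
    obtain ⟨U, hUo, hKU, hU⟩ := ih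
    obtain ⟨V, hVo, hpV, hV⟩ := exists_isOpen_hasMotionPlanner_of_mem hDo hD hdiag p
    obtain ⟨A, B, hA, hB, hpA, hKB, hAB⟩ :=
      SeparatedNhds.of_isCompact_isCompact (isCompact_singleton (x := p)) hK.isCompact
        (Set.disjoint_singleton_left.2 hp)
    refine ⟨V ∩ A ∪ U ∩ B, (hVo.inter hA).union (hUo.inter hB), ?_,
      (hV.mono Set.inter_subset_left).union (hU.mono Set.inter_subset_left) (hVo.inter hA)
        (hUo.inter hB) (hAB.mono Set.inter_subset_right Set.inter_subset_right)⟩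
    rintro q (rfl | hq)
    · exact .inl ⟨hpV, hpA rfl⟩
    · exact .inr ⟨hKU hq, hKB hq⟩

/-- If every diagonal point has a neighbourhood which some deformation of `X × X`, fixing the
diagonal, sweeps into the diagonal, then a composite of finitely many of these sweeps in a whole
neighbourhood of the diagonal, over which there is then a motion planner. -/
lemma exists_isOpen_diagonal_hasMotionPlanner [CompactSpace X]
    (h : ∀ x : X, ∃ g : C(X × X, X × X), g.Homotopic (.id _) ∧ (∀ y, g (y, y) = (y, y)) ∧
      ∀ᶠ p in 𝓝 (x, x), g p ∈ Set.diagonal X) :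
    ∃ D : Set (X × X), IsOpen D ∧ HasMotionPlanner D ∧ ∀ x, (x, x) ∈ D := by
  have key : ∃ g : C(X × X, X × X), g.Homotopic (.id _) ∧ (∀ y, g (y, y) = (y, y)) ∧
      ∀ x ∈ (Set.univ : Set X), ∀ᶠ p in 𝓝 (x, x), g p ∈ Set.diagonal X := by
    refine isCompact_univ.induction_on (p := fun S : Set X => ∃ g : C(X × X, X × X),
      g.Homotopic (.id _) ∧ (∀ y, g (y, y) = (y, y)) ∧
      ∀ x ∈ S, ∀ᶠ p in 𝓝 (x, x), g p ∈ Set.diagonal X) ?_ ?_ ?_ ?_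
    · exact ⟨.id _, .refl _, fun _ => rfl, by simp⟩
    · rintro S T hST ⟨g, h1, h2, h3⟩
      exact ⟨g, h1, h2, fun x hx => h3 x (hST hx)⟩
    · rintro S T ⟨g, h1, h2, h3⟩ ⟨g', h1', h2', h3'⟩
      refine ⟨g'.comp g, h1'.comp h1, fun y => by simp [h2, h2'], ?_⟩
      rintro x (hx | hx)
      · filter_upwards [h3 x hx] with p hp
        obtain ⟨a, ha⟩ : ∃ a, g p = (a, a) := ⟨(g p).1, Prod.ext rfl (Eq.symm hp)⟩
        simp [ha, h2']
      · have ht : Filter.Tendsto g (𝓝 (x, x)) (𝓝 (x, x)) := by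
          simpa [h2] using g.continuous.tendsto (x, x)
        exact ht.eventually (h3' x hx)
    · intro x _
      obtain ⟨g, h1, h2, h3⟩ := h x
      have ht : Filter.Tendsto (fun y : X => (y, y)) (𝓝 x) (𝓝 (x, x)) :=
        Continuous.tendsto (by fun_prop) x
      exact ⟨_, mem_nhdsWithin_of_mem_nhds (ht.eventually h3.eventually_nhds),
        g, h1, h2, fun y hy => hy⟩
  obtain ⟨g, h1, -, h3⟩ := key
  exact ⟨interior (g ⁻¹' Set.diagonal X), isOpen_interior,
    (hasMotionPlanner_diagonal.preimage h1).mono interior_subset,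
    fun x => mem_interior_iff_mem_nhds.2 (h3 x trivial)⟩

end MotionPlanner

/-! ### Relative topological complexity -/

section Covering

open ContinuousMap Topology

variable {X : Type*} [TopologicalSpace X]

/-- `A ⊆ X × X` is covered by at most `k` open subsets of `X × X` which admit motion planners. -/
def CoveredByPlanners (A : Set (X × X)) (k : ℕ∞) : Prop :=
  ∃ S : Set (Set (X × X)), S.encard ≤ k ∧ (∀ U ∈ S, IsOpen U ∧ HasMotionPlanner U) ∧ A ⊆ ⋃₀ S

lemma CoveredByPlanners.mono {A B : Set (X × X)} {k l : ℕ∞} (h : CoveredByPlanners B k)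
    (hAB : A ⊆ B) (hkl : k ≤ l) : CoveredByPlanners A l := by
  obtain ⟨S, h1, h2, h3⟩ := h
  exact ⟨S, h1.trans hkl, h2, hAB.trans h3⟩

lemma CoveredByPlanners.preimage {A : Set (X × X)} {k : ℕ∞} (h : CoveredByPlanners A k)
    {g : C(X × X, X × X)} (hg : g.Homotopic (.id _)) : CoveredByPlanners (g ⁻¹' A) k := by
  obtain ⟨S, h1, h2, h3⟩ := h
  refine ⟨(g ⁻¹' ·) '' S, (Set.encard_image_le _ _).trans h1, ?_, ?_⟩
  · rintro _ ⟨U, hU, rfl⟩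
    exact ⟨(h2 U hU).1.preimage g.continuous, (h2 U hU).2.preimage hg⟩
  · intro p hp
    obtain ⟨U, hU, hpU⟩ := h3 hp
    exact ⟨_, ⟨U, hU, rfl⟩, hpU⟩

lemma CoveredByPlanners.union {A U : Set (X × X)} {k : ℕ∞} (h : CoveredByPlanners A k)
    (hU : IsOpen U) (hUp : HasMotionPlanner U) : CoveredByPlanners (U ∪ A) (k + 1) := by
  obtain ⟨S, h1, h2, h3⟩ := h
  refine ⟨insert U S, (Set.encard_insert_le _ _).trans (by gcongr), ?_, ?_⟩
  · rintro V (rfl | hV)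
    exacts [⟨hU, hUp⟩, h2 V hV]
  · rw [Set.sUnion_insert]
    exact Set.union_subset_union_right _ h3

lemma topologicalComplexity_le_of_coveredByPlanners {k : ℕ∞}
    (h : CoveredByPlanners (Set.univ : Set (X × X)) k) : topologicalComplexity X ≤ k := by
  obtain ⟨S, h1, h2, h3⟩ := h
  by_cases hS : S.Finite
  · have := hS.to_subtype
    refine le_trans (sInf_le ⟨Nat.card S, rfl, fun i => ((Finite.equivFin S).symm i : Set _),
      fun i => h2 _ (Subtype.prop _), ?_⟩) (le_trans (le_of_eq ?_) h1)
    · rw [← Set.univ_subset_iff]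
      intro p hp
      obtain ⟨U, hU, hpU⟩ := h3 hp
      exact Set.mem_iUnion.2 ⟨Finite.equivFin S ⟨U, hU⟩, by rwa [Equiv.symm_apply_apply]⟩
    · rw [Nat.card_coe_set_eq, hS.cast_ncard_eq]
  · rw [Set.Infinite.encard_eq hS, top_le_iff] at h1
    simp [h1]

end Covering

/-! ### Lusternik–Schnirelmann theory for a continuous function -/

section LusternikSchnirelmann

open ContinuousMap Topology

variable {Y : Type*} [TopologicalSpace Y]

/-- `g` is homotopic to the identity and moves points only to where `f` is strictly smaller.
Nothing is required of `f` at the intermediate times of the homotopy. -/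
def IsDecreasingDeformation (f : Y → ℝ) (g : C(Y, Y)) : Prop :=
  g.Homotopic (.id _) ∧ ∀ q, g q = q ∨ f (g q) < f q

/-- `p` is a regular point of `f` if some decreasing deformation moves `p`. This replaces
the nonvanishing of the gradient. -/
def IsRegularPoint (f : Y → ℝ) (p : Y) : Prop :=
  ∃ g : C(Y, Y), IsDecreasingDeformation f g ∧ f (g p) < f p

lemma IsDecreasingDeformation.le {f : Y → ℝ} {g : C(Y, Y)} (h : IsDecreasingDeformation f g)
    (q : Y) : f (g q) ≤ f q := by
  rcases h.2 q with h | h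
  · rw [h]
  · exact h.le

lemma IsDecreasingDeformation.comp {f : Y → ℝ} {g g' : C(Y, Y)}
    (h' : IsDecreasingDeformation f g') (h : IsDecreasingDeformation f g) :
    IsDecreasingDeformation f (g'.comp g) := by
  refine ⟨h'.1.comp h.1, fun q => ?_⟩
  rcases h.2 q with hq | hq
  · simpa [hq] using h'.2 q
  · exact .inr ((h'.le _).trans_lt hq)

/-- A single decreasing deformation works on a compact set of regular points. -/
lemma exists_isDecreasingDeformation_of_isCompact {f : Y → ℝ} (hf : Continuous f) {K : Set Y}
    (hK : IsCompact K) (h : ∀ p ∈ K, IsRegularPoint f p) :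
    ∃ g : C(Y, Y), IsDecreasingDeformation f g ∧ ∀ p ∈ K, f (g p) < f p := by
  refine hK.induction_on (p := fun K => ∃ g : C(Y, Y), IsDecreasingDeformation f g ∧
    ∀ p ∈ K, f (g p) < f p) ?_ ?_ ?_ ?_
  · exact ⟨.id _, ⟨.refl _, fun _ => .inl rfl⟩, by simp⟩
  · rintro S T hST ⟨g, h1, h2⟩
    exact ⟨g, h1, fun x hx => h2 x (hST hx)⟩
  · rintro S T ⟨g, h1, h2⟩ ⟨g', h1', h2'⟩
    refine ⟨g'.comp g, h1'.comp h1, ?_⟩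
    rintro x (hx | hx)
    · exact (h1'.le _).trans_lt (h2 x hx)
    · rcases h1.2 x with hq | hq
      · simpa [hq] using h2' x hx
      · exact (h1'.le _).trans_lt hq
  · intro p hp
    obtain ⟨g, h1, h2⟩ := h p hp
    have : IsOpen {q | f (g q) < f q} := isOpen_lt (by fun_prop) hf
    exact ⟨_, mem_nhdsWithin_of_mem_nhds (this.mem_nhds h2), g, h1, fun q hq => hq⟩

/-- The deformation lemma: outside a neighbourhood `N` of the points at level `c` which are not
regular, sublevel sets just above `c` deform to just below `c`. -/
lemma exists_deformation_across_level [CompactSpace Y] [T2Space Y] {f : Y → ℝ} (hf : Continuous f)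
    {N : Set Y} (hN : IsOpen N) {c : ℝ} (h : ∀ p, f p = c → p ∉ N → IsRegularPoint f p) :
    ∃ ε > 0, ∃ g : C(Y, Y), g.Homotopic (.id _) ∧ ∀ p ∉ N, f p ≤ c + ε → f (g p) ≤ c - ε := by
  have hK : IsCompact ({p | f p = c} ∩ Nᶜ) :=
    ((isClosed_eq hf continuous_const).inter hN.isClosed_compl).isCompact
  obtain ⟨g, hg, hgK⟩ := exists_isDecreasingDeformation_of_isCompact hf hK
    fun p hp => h p hp.1 hp.2
  -- Off `N` either `f p > c`, or `f (g p) < c`; compactness makes this alternative quantitative.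
  obtain ⟨ε, hε, hle⟩ := hN.isClosed_compl.isCompact.exists_forall_le' (a := 0)
    (f := fun p => max (f p - c) (c - f (g p))) (by fun_prop) (fun p hp => by
      rcases lt_trichotomy (f p) c with hc | hc | hc
      · exact lt_max_of_lt_right (by linarith [hg.le p])
      · exact lt_max_of_lt_right (by linarith [hgK p ⟨hc, hp⟩])
      · exact lt_max_of_lt_left (by linarith))
  refine ⟨ε / 2, by linarith, g, hg.1, fun p hp hpc => ?_⟩
  rcases le_max_iff.1 (hle p hp) with h | h <;> linarith

variable {X : Type*} [TopologicalSpace X] [CompactSpace X] [T2Space X] [ConnectedSpace X]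

/-- Passing a level costs one further open set if the level contains points of the finite set `K` of
non-regular points, and none otherwise. Near the level `0` the diagonal neighbourhood `D` suffices,
and the count starts there. -/
theorem topologicalComplexity_le_encard_add_one {D : Set (X × X)} (hDo : IsOpen D)
    (hD : HasMotionPlanner D) (hdiag : ∀ x : X, (x, x) ∈ D) {f : X × X → ℝ} (hf : Continuous f)
    (hf0 : ∀ p, 0 ≤ f p) (hfd : ∀ p, f p = 0 ↔ p.1 = p.2) {K : Set (X × X)} (hK : K.Finite)
    (hreg : ∀ p, p.1 ≠ p.2 → p ∉ K → IsRegularPoint f p) :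
    topologicalComplexity X ≤ (f '' K).encard + 1 := by
  let count : ℝ → ℕ∞ := fun c => (f '' K ∩ Set.Iic c).encard
  let P : ℝ → Prop := fun c => CoveredByPlanners {p | f p ≤ c} (count c + 1)
  have hcount : ∀ {c c'}, c ≤ c' → count c ≤ count c' := fun h =>
    Set.encard_le_encard (Set.inter_subset_inter_right _ (Set.Iic_subset_Iic.2 h))
  have hbase : ∃ ε > 0, ∀ c ≤ ε, P c := by
    obtain ⟨ε, hε, hle⟩ := hDo.isClosed_compl.isCompact.exists_forall_le' (a := 0) (f := f)
      hf.continuousOn (fun p hp => (hf0 p).lt_of_ne fun h => hp (by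
        have := hdiag p.1
        rwa [show (p.1, p.1) = p from Prod.ext rfl ((hfd p).1 h.symm)] at this))
    refine ⟨ε / 2, by linarith, fun c hc => ?_⟩
    refine ⟨{D}, by simp, by simp [hDo, hD], fun p hp => ?_⟩
    by_contra hpD
    have h1 := hle p (by simpa using hpD)
    have h2 : f p ≤ c := hp
    linarith
  have hstep : ∀ s > 0, ∃ ε > 0, ∀ c' < s, s - ε ≤ c' → P c' → ∀ c, s ≤ c → c ≤ s + ε → P c := by
    intro s hs
    have hs' : ∀ p, f p = s → p.1 ≠ p.2 := fun p hp hp' => hs.ne' (hp ▸ (hfd p).2 hp')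
    by_cases hsK : s ∈ f '' K
    · obtain ⟨N, hNo, hKN, hN⟩ := exists_isOpen_hasMotionPlanner_of_finite hDo hD hdiag hK
      obtain ⟨ε, hε, g, hg, hgN⟩ := exists_deformation_across_level hf hNo
        fun p hp hpN => hreg p (hs' p hp) fun h => hpN (hKN h)
      refine ⟨ε, hε, fun c' hc's hc' hP c hsc hc => ?_⟩
      refine ((hP.preimage hg).union hNo hN).mono (fun p hp => ?_) ?_
      · by_cases hpN : p ∈ N
        · exact .inl hpN
        · exact .inr ((hgN p hpN (le_trans hp hc)).trans hc')
      · have h1 : s ∉ f '' K ∩ Set.Iic c' := fun h => hc's.not_ge h.2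
        rw [← Set.encard_insert_of_notMem h1]
        gcongr
        exact Set.encard_le_encard (Set.insert_subset ⟨hsK, hsc⟩
          (Set.inter_subset_inter_right _ (Set.Iic_subset_Iic.2 (hc's.le.trans hsc))))
    · obtain ⟨ε, hε, g, hg, hgN⟩ := exists_deformation_across_level (c := s) hf isOpen_empty
        fun p hp _ => hreg p (hs' p hp) fun h => hsK ⟨p, h, hp⟩
      refine ⟨ε, hε, fun c' hc's hc' hP c hsc hc => ?_⟩
      refine (hP.preimage hg).mono (fun p hp => ?_) ?_
      · exact (hgN p (Set.notMem_empty p) (le_trans hp hc)).trans hc'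
      · gcongr
        exact hcount (hc's.le.trans hsc)
  have hall : ∀ c, P c := by
    -- The infimum of the levels where `P` fails is positive by `hbase`, and `hstep` carries `P`
    -- from below it to beyond it.
    by_contra! hcon
    obtain ⟨ε₀, hε₀, hP₀⟩ := hbase
    have hlb : ∀ c ∈ {c | ¬ P c}, ε₀ ≤ c := fun c hc => le_of_not_ge fun h => hc (hP₀ c h)
    have hs : ε₀ ≤ sInf {c | ¬ P c} := le_csInf hcon hlb
    obtain ⟨ε, hε, h⟩ := hstep (sInf {c | ¬ P c}) (by linarith)
    obtain ⟨c, hc, hcs⟩ := exists_lt_of_csInf_lt hcon (lt_add_of_pos_right (sInf {c | ¬ P c}) hε)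
    refine hc (h (sInf {c | ¬ P c} - ε) (by linarith) le_rfl ?_ c (csInf_le ⟨ε₀, hlb⟩ hc) hcs.le)
    by_contra hn
    have := csInf_le ⟨ε₀, hlb⟩ hn
    linarith
  obtain ⟨B, hB⟩ := (isCompact_range hf).bddAbove
  refine topologicalComplexity_le_of_coveredByPlanners ((hall B).mono (fun p _ => hB ⟨p, rfl⟩) ?_)
  gcongr
  exact Set.encard_le_encard Set.inter_subset_left

end LusternikSchnirelmann

/-! ### Pushing points along a hypersurface -/

section Hypersurface

open ContinuousMap Topology

variable {n : ℕ} {M : Set (EuclideanSpace ℝ (Fin n))}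
  {Φ : OpenPartialHomeomorph (EuclideanSpace ℝ (Fin n)) (EuclideanSpace ℝ (Fin n))} {i : Fin n}

lemma chart_symm_mem (hΦ : ∀ p ∈ Φ.source, p ∈ M ↔ Φ p i = 0) {u : EuclideanSpace ℝ (Fin n)}
    (hu : u ∈ Φ.target) (hui : u i = 0) : Φ.symm u ∈ M :=
  (hΦ _ (Φ.map_target hu)).2 (by rwa [Φ.right_inv hu])

/-- In a flattening chart, translate the first coordinate of `M × M` by a displacement `e` parallel
to `M`, damped by a cutoff function `Λ`. The result is a deformation of `M × M`. -/
lemma exists_chart_push (hΦ : ∀ p ∈ Φ.source, p ∈ M ↔ Φ p i = 0) {W : Set (M × M)}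
    (hW : IsOpen W) (hWs : ∀ p ∈ W, (p.1 : EuclideanSpace ℝ (Fin n)) ∈ Φ.source)
    {Λ : C(M × M, ℝ)} (hΛ : tsupport Λ ⊆ W) (hΛI : ∀ p, Λ p ∈ Set.Icc (0 : ℝ) 1)
    {e : M × M → EuclideanSpace ℝ (Fin n)} (he : ContinuousOn e W) (hei : ∀ p ∈ W, e p i = 0)
    (het : ∀ p ∈ W, ∀ s ∈ Set.Icc (0 : ℝ) 1, Φ p.1 + s • e p ∈ Φ.target) :
    ∃ g : C(M × M, M × M), g.Homotopic (.id _) ∧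
      (∀ p ∈ W, ((g p).1 : EuclideanSpace ℝ (Fin n)) = Φ.symm (Φ p.1 + Λ p • e p)) ∧
      (∀ p, Λ p • e p = 0 → g p = p) ∧ ∀ p, (g p).2 = p.2 := by
  classical
  let F : I × (M × M) → EuclideanSpace ℝ (Fin n) := fun q =>
    if q.2 ∈ W then Φ.symm (Φ q.2.1 + ((q.1 : ℝ) * Λ q.2) • e q.2) else q.2.1
  have hmul : ∀ q : I × (M × M), (q.1 : ℝ) * Λ q.2 ∈ Set.Icc (0 : ℝ) 1 := fun q =>
    unitInterval.mul_mem q.1.2 (hΛI q.2)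
  have hFW : ∀ q : I × (M × M), q.2 ∈ W →
      F q = Φ.symm (Φ q.2.1 + ((q.1 : ℝ) * Λ q.2) • e q.2) := fun q hq => if_pos hq
  have hF0 : ∀ q : I × (M × M), ((q.1 : ℝ) * Λ q.2) • e q.2 = 0 → F q = q.2.1 := by
    intro q hq
    by_cases hqW : q.2 ∈ W
    · rw [hFW q hqW, hq, add_zero, Φ.left_inv (hWs _ hqW)]
    · exact if_neg hqW
  have hFM : ∀ q, F q ∈ M := by
    intro q
    by_cases hqW : q.2 ∈ W
    · rw [hFW q hqW]
      refine chart_symm_mem hΦ (het _ hqW _ (hmul q)) ?_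
      simp [hei _ hqW, (hΦ _ (hWs _ hqW)).1 q.2.1.2]
    · simp only [F, if_neg hqW, Subtype.coe_prop]
  have hFc : Continuous F := by
    refine continuous_iff_continuousAt.2 fun q => ?_
    by_cases hqW : q.2 ∈ W
    · have hopen : IsOpen (Prod.snd ⁻¹' W : Set (I × (M × M))) := hW.preimage continuous_snd
      refine ContinuousOn.continuousAt (ContinuousOn.congr ?_ fun q hq => hFW q hq)
        (hopen.mem_nhds hqW)
      refine Φ.continuousOn_symm.comp ?_ fun q hq => het _ hq _ (hmul q)
      have hmulc : Continuous fun q : I × (M × M) => (q.1 : ℝ) * Λ q.2 := by fun_prop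
      refine ContinuousOn.add ?_ (hmulc.continuousOn.smul
        (he.comp continuous_snd.continuousOn fun q hq => hq))
      exact Φ.continuousOn.comp (by fun_prop) fun q hq => hWs _ hq
    · have hopen : IsOpen (Prod.snd ⁻¹' (tsupport Λ)ᶜ : Set (I × (M × M))) :=
        (isClosed_tsupport _).isOpen_compl.preimage continuous_snd
      refine ContinuousOn.continuousAt (ContinuousOn.congr
        (f := fun q : I × (M × M) => (q.2.1 : EuclideanSpace ℝ (Fin n))) (by fun_prop)
        fun q hq => hF0 q ?_) (hopen.mem_nhds fun h => hqW (hΛ h))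
      simp [image_eq_zero_of_notMem_tsupport hq]
  let G : C(I × (M × M), M × M) := ⟨fun q => (⟨F q, hFM q⟩, q.2.2), by fun_prop⟩
  refine ⟨⟨fun p => G (1, p), by fun_prop⟩, Homotopic.symm ⟨⟨G, fun p => ?_, fun p => rfl⟩⟩,
    fun p hp => ?_, fun p hp => ?_, fun p => rfl⟩
  · exact Prod.ext (Subtype.ext (hF0 (0, p) (by simp))) rfl
  · exact (hFW (1, p) hp).trans (by simp)
  · exact Prod.ext (Subtype.ext (hF0 (1, p) (by simpa using hp))) rfl

lemma exists_cutoff [CompactSpace M] {W : Set (M × M)} (hW : IsOpen W) {p : M × M} (hp : p ∈ W) :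
    ∃ Λ : C(M × M, ℝ), tsupport Λ ⊆ W ∧ (∀ q, Λ q ∈ Set.Icc (0 : ℝ) 1) ∧ ∀ᶠ q in 𝓝 p, Λ q = 1 := by
  obtain ⟨t, ht, htc, htW⟩ := exists_mem_nhds_isClosed_subset (hW.mem_nhds hp)
  obtain ⟨Λ, h1, h2, h3⟩ :=
    exists_tsupport_one_of_isOpen_isClosed hW isClosed_closure.isCompact htc htW
  exact ⟨Λ, h1, h3, Filter.mem_of_superset ht fun q hq => h2 hq⟩

/-- Near `(x, x)`, the first coordinate is moved onto the second one along the straight segment in a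
flattening chart. -/
lemma exists_deformation_near_diagonal [CompactSpace M] (hM : IsSmoothHypersurface M) (x : M) :
    ∃ g : C(M × M, M × M), g.Homotopic (.id _) ∧ (∀ y, g (y, y) = (y, y)) ∧
      ∀ᶠ p in 𝓝 (x, x), g p ∈ Set.diagonal M := by
  obtain ⟨Φ, hx, -, -, i, hΦ⟩ := hM x x.2
  obtain ⟨r, hr, hball⟩ := Metric.isOpen_iff.1 Φ.open_target _ (Φ.map_source hx)
  have hxb : Φ x ∈ Metric.ball (Φ x) r := Metric.mem_ball_self hr
  obtain ⟨O, hO, hxO, hOs, hOb⟩ : ∃ O, IsOpen O ∧ (x : EuclideanSpace ℝ (Fin n)) ∈ O ∧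
      O ⊆ Φ.source ∧ ∀ y ∈ O, Φ y ∈ Metric.ball (Φ x) r :=
    ⟨Φ.source ∩ Φ ⁻¹' Metric.ball (Φ x) r, Φ.isOpen_inter_preimage Metric.isOpen_ball, ⟨hx, hxb⟩,
      Set.inter_subset_left, fun y hy => hy.2⟩
  let W : Set (M × M) := {p | (p.1 : EuclideanSpace ℝ (Fin n)) ∈ O ∧
    (p.2 : EuclideanSpace ℝ (Fin n)) ∈ O}
  have hW : IsOpen W :=
    (hO.preimage (continuous_subtype_val.comp continuous_fst)).inter
      (hO.preimage (continuous_subtype_val.comp continuous_snd))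
  obtain ⟨Λ, hΛ, hΛI, hΛ1⟩ := exists_cutoff hW (show (x, x) ∈ W from ⟨hxO, hxO⟩)
  let e : M × M → EuclideanSpace ℝ (Fin n) := fun p => Φ p.2 - Φ p.1
  have he : ContinuousOn e W :=
    (Φ.continuousOn.comp (f := fun p : M × M => (p.2 : EuclideanSpace ℝ (Fin n))) (by fun_prop)
      fun p hp => hOs hp.2).sub
    (Φ.continuousOn.comp (f := fun p : M × M => (p.1 : EuclideanSpace ℝ (Fin n))) (by fun_prop)
      fun p hp => hOs hp.1)
  have hei : ∀ p ∈ W, e p i = 0 := fun p hp => by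
    simp [e, (hΦ _ (hOs hp.1)).1 p.1.2, (hΦ _ (hOs hp.2)).1 p.2.2]
  have het : ∀ p ∈ W, ∀ s ∈ Set.Icc (0 : ℝ) 1, Φ p.1 + s • e p ∈ Φ.target := fun p hp s hs =>
    hball ((convex_ball _ _).add_smul_sub_mem (hOb _ hp.1) (hOb _ hp.2) hs)
  obtain ⟨g, hg, hgW, hg0, hg2⟩ :=
    exists_chart_push hΦ hW (fun p hp => hOs hp.1) hΛ hΛI he hei het
  refine ⟨g, hg, fun y => hg0 _ (by simp [e]), ?_⟩
  filter_upwards [hΛ1, hW.mem_nhds (show (x, x) ∈ W from ⟨hxO, hxO⟩)] with p hp1 hpW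
  refine Subtype.ext ?_
  rw [hgW p hpW, hg2, hp1, one_smul]
  simp only [e]
  rw [add_sub_cancel, Φ.left_inv (hOs hpW.2)]

/-! ### Regular points of the squared distance -/

/-- The decrease of `ψ` in a direction of negative derivative is uniform in the base point because
the derivative is strict. -/
lemma HasStrictFDerivAt.eventually_lt_of_neg {E : Type*} [NormedAddCommGroup E] [NormedSpace ℝ E]
    {ψ : E → ℝ} {L : E →L[ℝ] ℝ} {a w : E} (h : HasStrictFDerivAt ψ L a) (hw : L w < 0) :
    ∀ᶠ z : E × ℝ in 𝓝 (a, 0), 0 < z.2 → ψ (z.1 + z.2 • w) < ψ z.1 := by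
  have ht : Filter.Tendsto (fun z : E × ℝ => (z.1 + z.2 • w, z.1)) (𝓝 (a, 0)) (𝓝 (a, a)) := by
    have : Continuous fun z : E × ℝ => (z.1 + z.2 • w, z.1) := by fun_prop
    simpa using this.tendsto (a, 0)
  have hc : 0 < -L w / (‖w‖ + 1) := div_pos (by linarith) (by positivity)
  filter_upwards [ht.eventually (h.isLittleO.def hc)] with z hz hz0
  simp only [add_sub_cancel_left, map_smul, smul_eq_mul, norm_smul, Real.norm_eq_abs,
    _root_.abs_of_pos hz0] at hz
  have h1 : -L w / (‖w‖ + 1) * ‖w‖ < -L w := by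
    rw [div_mul_eq_mul_div, div_lt_iff₀ (by positivity)]
    nlinarith
  have h2 := (abs_le.1 hz).2
  nlinarith

/-- The squared distance, as a function on `M × M`. -/
noncomputable def sqDist (M : Set (EuclideanSpace ℝ (Fin n))) (p : M × M) : ℝ :=
  ‖(p.1 - p.2 : EuclideanSpace ℝ (Fin n))‖ ^ 2

lemma continuous_sqDist : Continuous (sqDist M) := by unfold sqDist; fun_prop

lemma IsRegularPoint.swap {p : M × M} (h : IsRegularPoint (sqDist M) p) :
    IsRegularPoint (sqDist M) p.swap := by
  obtain ⟨g, ⟨h1, h2⟩, h3⟩ := h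
  have hf : ∀ q : M × M, sqDist M q.swap = sqDist M q := fun q => by
    simp [sqDist, norm_sub_rev]
  let τ : C(M × M, M × M) := ⟨Prod.swap, continuous_swap⟩
  refine ⟨τ.comp (g.comp τ), ⟨?_, fun q => ?_⟩, ?_⟩
  · have := (Homotopic.refl τ).comp (h1.comp (.refl τ))
    exact this.trans (.refl _)
  · rcases h2 q.swap with h | h
    · exact .inl (by simp [τ, h])
    · exact .inr (by simpa [τ, hf] using h)
  · simpa [τ, hf] using h3

/-- A curve in `M` has coordinate `i` equal to zero in the chart, so its velocity does too. -/
lemma fderiv_chart_apply_of_mem_tangentSpaceAt (hΦ : ∀ p ∈ Φ.source, p ∈ M ↔ Φ p i = 0)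
    (hΦd : ContDiffOn ℝ ∞ Φ Φ.source) {x v : EuclideanSpace ℝ (Fin n)} (hx : x ∈ Φ.source)
    (hv : v ∈ tangentSpaceAt M x) : fderiv ℝ Φ x v i = 0 := by
  obtain ⟨ε, hε, γ, hγ, hγM, rfl, hγd⟩ := hv
  have hd : DifferentiableAt ℝ Φ (γ 0) :=
    (hΦd.contDiffAt (Φ.open_source.mem_nhds hx)).differentiableAt (by simp)
  have h1 : HasDerivAt (fun t => Φ (γ t)) (fderiv ℝ Φ (γ 0) v) 0 :=
    hd.hasFDerivAt.comp_hasDerivAt 0 hγd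
  have h2 : HasDerivAt (fun t => Φ (γ t) i) (fderiv ℝ Φ (γ 0) v i) 0 :=
    (EuclideanSpace.proj (𝕜 := ℝ) i).hasFDerivAt.comp_hasDerivAt 0 h1
  have h3 : (fun t => Φ (γ t) i) =ᶠ[𝓝 0] fun _ => 0 := by
    filter_upwards [Ioo_mem_nhds (neg_lt_zero.2 hε) hε,
      hγd.continuousAt.eventually_mem (Φ.open_source.mem_nhds hx)] with t ht hts
    exact (hΦ _ hts).1 (hγM t ht)
  exact h2.unique ((hasDerivAt_const (0 : ℝ) (0 : ℝ)).congr_of_eventuallyEq h3)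

lemma fderiv_symm_fderiv_chart (hΦd : ContDiffOn ℝ ∞ Φ Φ.source)
    (hΦs : ContDiffOn ℝ ∞ Φ.symm Φ.target) {x : EuclideanSpace ℝ (Fin n)} (hx : x ∈ Φ.source)
    (v : EuclideanSpace ℝ (Fin n)) : fderiv ℝ Φ.symm (Φ x) (fderiv ℝ Φ x v) = v := by
  have hd : DifferentiableAt ℝ Φ x :=
    (hΦd.contDiffAt (Φ.open_source.mem_nhds hx)).differentiableAt (by simp)
  have hs : DifferentiableAt ℝ Φ.symm (Φ x) :=
    (hΦs.contDiffAt (Φ.open_target.mem_nhds (Φ.map_source hx))).differentiableAt (by simp)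
  have h1 := hs.hasFDerivAt.comp x hd.hasFDerivAt
  have h2 : (Φ.symm ∘ Φ) =ᶠ[𝓝 x] id := by
    filter_upwards [Φ.open_source.mem_nhds hx] with y hy using Φ.left_inv hy
  exact DFunLike.congr_fun (h1.unique ((hasFDerivAt_id x).congr_of_eventuallyEq h2)) v

/-- Coordinate lines in the chart are curves in `M`. -/
lemma fderiv_symm_mem_tangentSpaceAt (hΦ : ∀ p ∈ Φ.source, p ∈ M ↔ Φ p i = 0)
    (hΦs : ContDiffOn ℝ ∞ Φ.symm Φ.target) {x : EuclideanSpace ℝ (Fin n)} (hx : x ∈ Φ.source)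
    (hxM : x ∈ M) {u : EuclideanSpace ℝ (Fin n)} (hu : u i = 0) :
    fderiv ℝ Φ.symm (Φ x) u ∈ tangentSpaceAt M x := by
  have hs : DifferentiableAt ℝ Φ.symm (Φ x) :=
    (hΦs.contDiffAt (Φ.open_target.mem_nhds (Φ.map_source hx))).differentiableAt (by simp)
  have hl : ContDiff ℝ ∞ fun t : ℝ => Φ x + t • u := by fun_prop
  have hmem : ∀ᶠ t : ℝ in 𝓝 0, Φ x + t • u ∈ Φ.target :=
    hl.continuous.continuousAt.eventually_mem
      (Φ.open_target.mem_nhds (by simpa using Φ.map_source hx))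
  obtain ⟨ε, hε, hball⟩ := Metric.eventually_nhds_iff_ball.1 hmem
  rw [Real.ball_eq_Ioo, zero_sub, zero_add] at hball
  refine ⟨ε, hε, fun t => Φ.symm (Φ x + t • u), hΦs.comp hl.contDiffOn hball, fun t ht => ?_,
    by simp [Φ.left_inv hx], ?_⟩
  · exact chart_symm_mem hΦ (hball t ht) (by simp [hu, (hΦ x hx).1 hxM])
  · have h1 : HasDerivAt (fun t : ℝ => Φ x + t • u) u 0 := by
      simpa using ((hasDerivAt_id (0 : ℝ)).smul_const u).const_add (Φ x)
    have h2 : HasFDerivAt Φ.symm (fderiv ℝ Φ.symm (Φ x)) (Φ x + (0 : ℝ) • u) := by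
      simpa using hs.hasFDerivAt
    exact h2.comp_hasDerivAt 0 h1

/-- As `T_xM` is a hyperplane, it equals every hyperplane which contains it. -/
lemma tangentSpaceAt_eq_of_forall_inner_eq_zero (hM : IsSmoothHypersurface M)
    {x z : EuclideanSpace ℝ (Fin n)} (hx : x ∈ M) (hz : z ≠ 0)
    (h : ∀ v ∈ tangentSpaceAt M x, inner ℝ z v = 0) :
    tangentSpaceAt M x = {v | inner ℝ z v = 0} := by
  obtain ⟨Φ, hxs, hΦd, hΦs, i, hΦ⟩ := hM x hx
  refine Set.Subset.antisymm h fun v (hv : inner ℝ z v = 0) => ?_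
  set A := fderiv ℝ Φ.symm (Φ x)
  set B := fderiv ℝ Φ x
  have hAB : ∀ v, A (B v) = v := fderiv_symm_fderiv_chart hΦd hΦs hxs
  -- The functional `u ↦ ⟪z, A u⟫` vanishes where `u i = 0`, so it is a multiple of `u ↦ u i`.
  have hfun : ∀ u, inner ℝ z (A u) = u i * inner ℝ z (A (EuclideanSpace.single i 1)) := by
    intro u
    have h0 : (u - u i • EuclideanSpace.single i (1 : ℝ)) i = 0 := by simp
    have := h _ (fderiv_symm_mem_tangentSpaceAt hΦ hΦs hxs hx h0)
    change inner ℝ z (A _) = 0 at this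
    rwa [map_sub, map_smul, inner_sub_right, inner_smul_right, sub_eq_zero] at this
  have hne : inner ℝ z (A (EuclideanSpace.single i 1)) ≠ 0 := fun h0 => by
    have := hfun (B z)
    rw [hAB, h0, mul_zero, inner_self_eq_zero] at this
    exact hz this
  have hBv : B v i = 0 := by
    have := hfun (B v)
    rw [hAB, hv, eq_comm, mul_eq_zero] at this
    exact this.resolve_right hne
  have := fderiv_symm_mem_tangentSpaceAt hΦ hΦs hxs hx hBv
  rwa [show fderiv ℝ Φ.symm (Φ x) (B v) = v from hAB v] at this

lemma isRegularPoint_of_inner_ne_zero [CompactSpace M] (hM : IsSmoothHypersurface M) {p : M × M}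
    {v : EuclideanSpace ℝ (Fin n)} (hv : v ∈ tangentSpaceAt M p.1)
    (h : inner ℝ (p.1 - p.2 : EuclideanSpace ℝ (Fin n)) v ≠ 0) :
    IsRegularPoint (sqDist M) p := by
  obtain ⟨Φ, hx, hΦd, hΦs, i, hΦ⟩ := hM p.1 p.1.2
  let A := fderiv ℝ Φ.symm (Φ p.1)
  -- the chart representation of the tangent vector, scaled so that the distance decreases
  let w := -(inner ℝ (p.1 - p.2 : EuclideanSpace ℝ (Fin n)) v) • fderiv ℝ Φ p.1 v
  have hwi : w i = 0 := by
    simp [w, fderiv_chart_apply_of_mem_tangentSpaceAt hΦ hΦd hx hv]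
  have hAw : inner ℝ (p.1 - p.2 : EuclideanSpace ℝ (Fin n)) (A w) < 0 := by
    simp only [A, w, map_smul, fderiv_symm_fderiv_chart hΦd hΦs hx, inner_smul_right]
    nlinarith [sq_pos_of_ne_zero h]
  let ψ : EuclideanSpace ℝ (Fin n) × EuclideanSpace ℝ (Fin n) → ℝ :=
    fun q => ‖Φ.symm q.1 - q.2‖ ^ 2
  have hψ : ∃ L : (EuclideanSpace ℝ (Fin n) × EuclideanSpace ℝ (Fin n)) →L[ℝ] ℝ,
      HasStrictFDerivAt ψ L (Φ p.1, (p.2 : EuclideanSpace ℝ (Fin n))) ∧ L (w, 0) < 0 := by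
    have h1 : HasStrictFDerivAt Φ.symm A (Φ p.1) :=
      (hΦs.contDiffAt (Φ.open_target.mem_nhds (Φ.map_source hx))).hasStrictFDerivAt (by simp)
    have h2 : HasStrictFDerivAt (fun q : EuclideanSpace ℝ (Fin n) × EuclideanSpace ℝ (Fin n) =>
        Φ.symm q.1 - q.2) _ (Φ p.1, (p.2 : EuclideanSpace ℝ (Fin n))) :=
      (h1.comp (Φ p.1, (p.2 : EuclideanSpace ℝ (Fin n))) hasStrictFDerivAt_fst).sub
        hasStrictFDerivAt_snd
    refine ⟨_, (hasStrictFDerivAt_norm_sq _).comp _ h2, ?_⟩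
    have : 2 * inner ℝ (p.1 - p.2 : EuclideanSpace ℝ (Fin n)) (A w) < 0 := by linarith
    simpa [Φ.left_inv hx, ← inner_sub_left] using this
  obtain ⟨L, hL, hLw⟩ := hψ
  have hev : ∀ᶠ z : (EuclideanSpace ℝ (Fin n) × EuclideanSpace ℝ (Fin n)) × ℝ in
      𝓝 ((Φ p.1, (p.2 : EuclideanSpace ℝ (Fin n))), 0),
      (0 < z.2 → ψ (z.1 + z.2 • (w, 0)) < ψ z.1) ∧ z.1.1 + z.2 • w ∈ Φ.target := by
    refine (hL.eventually_lt_of_neg hLw).and ?_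
    have : Continuous fun z : (EuclideanSpace ℝ (Fin n) × EuclideanSpace ℝ (Fin n)) × ℝ =>
      z.1.1 + z.2 • w := by fun_prop
    exact this.continuousAt.eventually_mem
      (Φ.open_target.mem_nhds (by simpa using Φ.map_source hx))
  rw [nhds_prod_eq, Filter.eventually_prod_iff] at hev
  obtain ⟨P, hP, Q, hQ, hPQ⟩ := hev
  obtain ⟨δ, hδ, hball⟩ := Metric.eventually_nhds_iff_ball.1 hQ
  have hQδ : ∀ s ∈ Set.Icc (0 : ℝ) 1, Q (s * (δ / 2)) := fun s hs => hball _ (by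
    rw [mem_ball_zero_iff, Real.norm_eq_abs, abs_of_nonneg (mul_nonneg hs.1 (by linarith))]
    nlinarith [hs.2])
  have hW : ∀ᶠ q : M × M in 𝓝 p, (q.1 : EuclideanSpace ℝ (Fin n)) ∈ Φ.source ∧
      P (Φ q.1, (q.2 : EuclideanSpace ℝ (Fin n))) := by
    have hc : ContinuousAt (fun q : M × M => (q.1 : EuclideanSpace ℝ (Fin n))) p := by fun_prop
    refine (hc.eventually_mem (Φ.open_source.mem_nhds hx)).and ?_
    have h1 : ContinuousAt (fun q : M × M => Φ q.1) p :=
      ContinuousAt.comp (g := Φ) (Φ.continuousAt hx) hc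
    exact (h1.prodMk (f := fun q : M × M => Φ q.1)
      (g := fun q : M × M => (q.2 : EuclideanSpace ℝ (Fin n))) (by fun_prop)).eventually hP
  obtain ⟨W, hWP, hWo, hpW⟩ := eventually_nhds_iff.1 hW
  obtain ⟨Λ, hΛ, hΛI, hΛ1⟩ := exists_cutoff hWo hpW
  obtain ⟨g, hg, hgW, hg0, hg2⟩ := exists_chart_push hΦ hWo (fun q hq => (hWP q hq).1) hΛ hΛI
    (e := fun _ => (δ / 2) • w) (by fun_prop) (by simp [hwi]) (fun q hq s hs => by
      rw [smul_smul]
      exact (hPQ (hWP q hq).2 (hQδ s hs)).2)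
  have hlt : ∀ q ∈ W, 0 < Λ q → sqDist M (g q) < sqDist M q := by
    intro q hq hΛq
    have := (hPQ (hWP q hq).2 (hQδ _ (hΛI q))).1 (by positivity)
    simpa [ψ, sqDist, hgW q hq, hg2, smul_smul, Φ.left_inv (hWP q hq).1] using this
  refine ⟨g, ⟨hg, fun q => ?_⟩, hlt p hpW (by simp [hΛ1.self_of_nhds])⟩
  by_cases hΛq : Λ q = 0
  · exact .inl (hg0 q (by simp [hΛq]))
  · exact .inr (hlt q (hΛ (subset_tsupport _ hΛq)) ((hΛI q).1.lt_of_ne' hΛq))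

lemma isRegularPoint_of_notMem_doubleNormalPairs [CompactSpace M] (hM : IsSmoothHypersurface M)
    {p : M × M} (hne : p.1 ≠ p.2)
    (hp : s((p.1 : EuclideanSpace ℝ (Fin n)), (p.2 : EuclideanSpace ℝ (Fin n))) ∉
      doubleNormalPairs M) : IsRegularPoint (sqDist M) p := by
  by_contra hreg
  have hne' : (p.1 - p.2 : EuclideanSpace ℝ (Fin n)) ≠ 0 :=
    sub_ne_zero.2 fun h => hne (Subtype.ext h)
  have h1 := tangentSpaceAt_eq_of_forall_inner_eq_zero hM p.1.2 hne' fun v hv => by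
    by_contra h
    exact hreg (isRegularPoint_of_inner_ne_zero hM hv h)
  have h2 := tangentSpaceAt_eq_of_forall_inner_eq_zero hM p.2.2 hne' fun v hv => by
    by_contra h
    refine hreg (IsRegularPoint.swap (p := p.swap)
      (isRegularPoint_of_inner_ne_zero hM (p := p.swap) hv ?_))
    rwa [Prod.fst_swap, Prod.snd_swap, ← neg_sub, inner_neg_left, neg_ne_zero]
  exact hp ⟨p.1, p.1.2, p.2, p.2.2, rfl, fun h => hne (Subtype.ext h), h1.trans h2.symm, h2⟩

end Hypersurface

/-! ### Counting double normals -/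

theorem theorem3p4 (n : ℕ) (M : Set (EuclideanSpace ℝ (Fin n))) (hM : IsSmoothHypersurface M)
    (hcompact : IsCompact M) (hconn : IsConnected M) :
    topologicalComplexity M - 1 ≤ alphaCount M ∧
      topologicalComplexity M - 1 ≤ (parallelPairs M).encard := by
  have key : topologicalComplexity M - 1 ≤ alphaCount M := by
    have : CompactSpace M := isCompact_iff_compactSpace.1 hcompact
    have : ConnectedSpace M := isConnected_iff_connectedSpace.1 hconn
    by_cases hfin : (doubleNormalPairs M).Finite
    swap
    · rw [alphaCount, Set.Infinite.encard_eq hfin]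
      exact le_top
    obtain ⟨D, hDo, hD, hdiag⟩ :=
      exists_isOpen_diagonal_hasMotionPlanner (exists_deformation_near_diagonal hM)
    let π : M × M → Sym2 (EuclideanSpace ℝ (Fin n)) := fun p => s(p.1, p.2)
    -- an unordered pair has at most two orderings
    have hK : (π ⁻¹' doubleNormalPairs M).Finite := by
      refine hfin.preimage' fun z _ => ?_
      induction z with | h a b =>
      refine (((Set.finite_singleton (a, b)).insert (b, a)).preimage
        (Subtype.val_injective.prodMap Subtype.val_injective).injOn).subset fun q hq => ?_
      have := Sym2.eq_iff.1 (show s((q.1 : EuclideanSpace ℝ (Fin n)), _) = s(a, b) from hq)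
      simpa [Prod.ext_iff, or_comm] using this
    rw [tsub_le_iff_right]
    refine (topologicalComplexity_le_encard_add_one hDo hD hdiag continuous_sqDist
      (fun p => sq_nonneg _) (fun p => ?_) hK
      fun p hne hp => isRegularPoint_of_notMem_doubleNormalPairs hM hne hp).trans ?_
    · simp [sqDist, sub_eq_zero, Subtype.ext_iff]
    · -- the distance of two points depends only on the unordered pair
      let d : Sym2 (EuclideanSpace ℝ (Fin n)) → ℝ :=
        Sym2.lift ⟨fun a b => ‖a - b‖ ^ 2, fun a b => by simp [norm_sub_rev]⟩
      gcongr
      refine le_trans (Set.encard_le_encard ?_) (Set.encard_image_le d _)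
      rintro _ ⟨p, hp, rfl⟩
      exact ⟨π p, hp, rfl⟩
  refine ⟨key, key.trans (Set.encard_le_encard ?_)⟩
  rintro p ⟨x, hx, y, hy, h1, h2, h3, -⟩
  exact ⟨x, hx, y, hy, h1, h2, h3⟩
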